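/- For a real number $a$ write $(a)_0=1$ and $(a)_n=a(a+1)\cdots(a+n-1)$. Call a non-negative, not identically zero real sequence $\{h_k\}_{k\ge0}$ log-concave if $h_k^2\ge h_{k-1}h_{k+1}$ for all $k\ge1$ and its support is an interval of integers (that is, $h_N=0$ implies that $h_n=0$ for all $n\ge N$ or $h_n=0$ for all $n\le N$), and log-convex if $h_k^2\le h_{k-1}h_{k+1}$ for all $k\ge1$. Let $\{h_k\}_{k\ge0}$ be such a sequence, independent of $\mu$, and for $\mu\ge0$ let $$h(\mu;x)=\sum_{k=0}^\infty h_k\,\frac{(\mu)_{2k}}{(\mu+1)_k\,k!}\,x^k,\qquad \Delta_h(\alpha,\beta;x)=h(\mu+\alpha;x)h(\mu+\beta;x)-h(\mu;x)h(\mu+\alpha+\beta;x)=\sum_{k=0}^\infty\delta_kx^k,$$ where $h(\mu;x)$, and hence $\Delta_h(\alpha,\beta;x)$ and its coefficients $\delta_k=\delta_k(\mu,\alpha,\beta)$, are understood as formal power series in $x$. (1) If $\{h_k\}$ is log-concave (log-convex), then $\Delta_h(\alpha,\beta;x)\ge0$ (respectively $\Delta_h(\alpha,\beta;x)\le0$)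 for all $\mu\ge0$, all positive integers $\alpha,\beta$ and every $x\ge0$ at which the four series $h(\mu;x)$, $h(\mu+\alpha;x)$, $h(\mu+\beta;x)$, $h(\mu+\alpha+\beta;x)$ converge. (2) If $\{h_k\}$ is log-concave (log-convex), then $\delta_k\ge0$ (respectively $\delta_k\le0$) for all $k\ge0$, all $\mu\ge0$ and all positive integers $\alpha,\beta$ with $\alpha+\beta\le4$. -/

import Mathlib

/-- A non-negative, not identically zero sequence is log-concave if `f (k+1) ^ 2 ≥ f k * f (k+2)`
for all `k` and its support is an interval of integers. -/
structure IsLogConcaveSeq (f : ℕ → ℝ) : Prop where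
  nonneg : ∀ k, 0 ≤ f k
  nontrivial : ∃ k, f k ≠ 0
  ineq : ∀ k, f k * f (k + 2) ≤ f (k + 1) ^ 2
  support : ∀ N, f N = 0 → (∀ n, N ≤ n → f n = 0) ∨ (∀ n, n ≤ N → f n = 0)

/-- A non-negative, not identically zero sequence is log-convex if
`f (k+1) ^ 2 ≤ f k * f (k+2)` for all `k`. -/
structure IsLogConvexSeq (f : ℕ → ℝ) : Prop where
  nonneg : ∀ k, 0 ≤ f k
  nontrivial : ∃ k, f k ≠ 0
  ineq : ∀ k, f (k + 1) ^ 2 ≤ f k * f (k + 2)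

/-- The rising factorial `(a)_n = a (a+1) ⋯ (a+n-1)`. -/
noncomputable def risingFactorial (a : ℝ) (n : ℕ) : ℝ := (ascPochhammer ℝ n).eval a

/-- The formal power series `h(μ; x) = ∑ h_k (μ)_{2k} / ((μ+1)_k k!) x^k`. -/
noncomputable def hSeries (h : ℕ → ℝ) (μ : ℝ) : PowerSeries ℝ :=
  PowerSeries.mk fun k =>
    h k * (risingFactorial μ (2 * k) / (risingFactorial (μ + 1) k * (Nat.factorial k : ℝ)))

/-- The generalized Turanian of a family `μ ↦ f(μ; x)` of formal power series. -/
noncomputable def formalTuranian (f : ℝ → PowerSeries ℝ) (μ α β : ℝ) : PowerSeries ℝ :=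
  f (μ + α) * f (μ + β) - f μ * f (μ + α + β)

/-- The formal power series `p` converges at the real point `x`. For `p` with non-negative
coefficients and `x ≥ 0`, convergence and unconditional convergence coincide. -/
def SeriesConvergesAt (p : PowerSeries ℝ) (x : ℝ) : Prop :=
  Summable fun k => PowerSeries.coeff k p * x ^ k

/-- The sum of the power series `p` at the real point `x`. -/
noncomputable def seriesSum (p : PowerSeries ℝ) (x : ℝ) : ℝ :=
  ∑' k, PowerSeries.coeff k p * x ^ k

/-- All four series that occur in the generalized Turanian converge at `x`. -/
def TuranianConvergesAt (f : ℝ → PowerSeries ℝ) (μ α β x : ℝ) : Prop :=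
  SeriesConvergesAt (f (μ + α)) x ∧ SeriesConvergesAt (f (μ + β)) x ∧
    SeriesConvergesAt (f μ) x ∧ SeriesConvergesAt (f (μ + α + β)) x

/-- The value `f(μ+α; x) f(μ+β; x) - f(μ; x) f(μ+α+β; x)` of the generalized Turanian at `x`. -/
noncomputable def turanianValue (f : ℝ → PowerSeries ℝ) (μ α β x : ℝ) : ℝ :=
  seriesSum (f (μ + α)) x * seriesSum (f (μ + β)) x -
    seriesSum (f μ) x * seriesSum (f (μ + α + β)) x

open Finset Filter Topology

/-! For `a > 0`, `hCoeff k a` is the coefficient of `x^k` in `C^a`, where `C = 1 + x C^2` is the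
Catalan generating function. Hence for `h = 1` the Turanian vanishes identically: convolutions of
these coefficients depend only on the sum of the parameters (`sum_hCoeff_shift`).

For general `h`, the coefficient of `h(a+1) h(a+d) - h(a) h(a+d+1)` is this zero sum with weights `h
i * h l`, where `i + l = k`. Log-concavity makes the weights increase with `i * l`, log-convexity
makes them decrease. Symmetrized in `i` and `l`, the unweighted term is a positive factor times a
polynomial in `i * l` whose coefficients depend on `i + l`. For `d = 1, 2, 3` these coefficients
change sign at most once, from negative to positive, so positive terms have the larger `i * l` and
the weighted sum has the required sign (`sum_mul_shiftTerm_nonneg`). Since `α = β = 2` telescopes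
into gaps 1 and 3, this settles `α + β ≤ 4`.

For values at `x ≥ 0`, gap 1 alone suffices: it makes `n ↦ h(μ + n; x)` log-concave (log-convex),
and chaining unit steps gives arbitrary `α, β`. -/

/-- The coefficient `(a)_{2k} / ((a+1)_k k!)`. -/
noncomputable def hCoeff (k : ℕ) (a : ℝ) : ℝ :=
  risingFactorial a (2 * k) / (risingFactorial (a + 1) k * (Nat.factorial k : ℝ))

/-! ### Coefficients of powers of the Catalan generating function -/

lemma risingFactorial_zero (a : ℝ) : risingFactorial a 0 = 1 := by
  simp [risingFactorial]

lemma risingFactorial_succ (a : ℝ) (n : ℕ) :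
    risingFactorial a (n + 1) = risingFactorial a n * (a + n) := by
  simp [risingFactorial, ascPochhammer_succ_eval]

lemma risingFactorial_pos {a : ℝ} (ha : 0 < a) (n : ℕ) : 0 < risingFactorial a n :=
  ascPochhammer_pos n a ha

lemma risingFactorial_nonneg {a : ℝ} (ha : 0 ≤ a) (n : ℕ) : 0 ≤ risingFactorial a n := by
  induction n with
  | zero => simp [risingFactorial_zero]
  | succ n ih => rw [risingFactorial_succ]; positivity

lemma mul_risingFactorial_add_one (a : ℝ) (n : ℕ) :
    a * risingFactorial (a + 1) n = risingFactorial a n * (a + n) := by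
  induction n with
  | zero => simp [risingFactorial_zero]
  | succ n ih =>
    rw [risingFactorial_succ, risingFactorial_succ, ← mul_assoc, ih]
    push_cast; ring

lemma continuous_risingFactorial (n : ℕ) : Continuous fun a => risingFactorial a n :=
  (ascPochhammer ℝ n).continuous

lemma hCoeff_nonneg {a : ℝ} (ha : 0 ≤ a) (k : ℕ) : 0 ≤ hCoeff k a := by
  have h1 := risingFactorial_nonneg ha (2 * k)
  have h2 := risingFactorial_pos (by linarith : 0 < a + 1) k
  unfold hCoeff; positivity

lemma hCoeff_pos {a : ℝ} (ha : 0 < a) (k : ℕ) : 0 < hCoeff k a := by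
  have h1 := risingFactorial_pos ha (2 * k)
  have h2 := risingFactorial_pos (by linarith : 0 < a + 1) k
  unfold hCoeff; positivity

lemma hCoeff_zero (a : ℝ) : hCoeff 0 a = 1 := by
  simp [hCoeff, risingFactorial_zero]

lemma continuousAt_hCoeff {a : ℝ} (ha : 0 ≤ a) (k : ℕ) : ContinuousAt (hCoeff k) a := by
  have h2 := risingFactorial_pos (by linarith : 0 < a + 1) k
  unfold hCoeff
  refine ContinuousAt.div (continuous_risingFactorial _).continuousAt ?_ (by positivity)
  exact (((continuous_risingFactorial k).comp (continuous_id.add continuous_const)).mul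
    continuous_const).continuousAt

lemma hCoeff_add_one {a : ℝ} (ha : 0 < a) (k : ℕ) :
    hCoeff k (a + 1) = hCoeff k a * ((a + 1) * (a + 2 * k) / (a * (a + k + 1))) := by
  have h1 := mul_risingFactorial_add_one a (2 * k)
  have h2 := mul_risingFactorial_add_one (a + 1) k
  have h3 := risingFactorial_pos (by linarith : 0 < a + 1) k
  have h4 := risingFactorial_pos (by linarith : 0 < a + 1 + 1) k
  unfold hCoeff
  have e1 : risingFactorial (a + 1) (2 * k) = risingFactorial a (2 * k) * (a + 2 * k) / a := by
    rw [eq_div_iff ha.ne', mul_comm, h1]; push_cast; ring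
  have e2 : risingFactorial (a + 1 + 1) k = risingFactorial (a + 1) k * (a + 1 + k) / (a + 1) := by
    rw [eq_div_iff (by positivity), mul_comm, h2]
  rw [e1, e2]
  field_simp
  ring

lemma hCoeff_succ {a : ℝ} (ha : 0 < a) (k : ℕ) :
    hCoeff (k + 1) a =
      hCoeff k a * ((a + 2 * k) * (a + 2 * k + 1) / ((a + k + 1) * (k + 1))) := by
  have h3 := risingFactorial_pos (by linarith : 0 < a + 1) k
  unfold hCoeff
  rw [show 2 * (k + 1) = 2 * k + 1 + 1 by ring, risingFactorial_succ, risingFactorial_succ,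
    risingFactorial_succ, Nat.factorial_succ]
  push_cast
  field_simp
  ring

/-- Coefficient form of `C^(a+1) - C^a = x C^(a+2)`, which is `C = 1 + x C^2` multiplied by `C^a`.
-/
lemma hCoeff_succ_add_one_sub {a : ℝ} (ha : 0 < a) (k : ℕ) :
    hCoeff (k + 1) (a + 1) - hCoeff (k + 1) a = hCoeff k (a + 2) := by
  rw [show a + 2 = a + 1 + 1 by ring, hCoeff_add_one (by linarith : 0 < a + 1),
    hCoeff_add_one ha, hCoeff_add_one ha, hCoeff_succ ha]
  push_cast
  field_simp
  ring

lemma hCoeff_le_add_one {a : ℝ} (ha : 0 ≤ a) (k : ℕ) : hCoeff k a ≤ hCoeff k (a + 1) := by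
  cases k with
  | zero => simp [hCoeff_zero]
  | succ k =>
    rcases ha.eq_or_lt with rfl | ha
    · have : hCoeff (k + 1) 0 = 0 := by
        simp [hCoeff, risingFactorial, Nat.mul_add]
      rw [this]; exact hCoeff_nonneg (by norm_num) _
    · have := hCoeff_succ_add_one_sub ha k
      have := hCoeff_nonneg (by linarith : 0 ≤ a + 2) k
      linarith

/-- Shift invariance of the convolution of the coefficients (a form of the Rothe-Hagen
identity). -/
lemma sum_hCoeff_shift (k : ℕ) : ∀ {a b : ℝ}, 0 < a → 0 < b →
    ∑ p ∈ antidiagonal k, hCoeff p.1 (a + 1) * hCoeff p.2 b =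
      ∑ p ∈ antidiagonal k, hCoeff p.1 a * hCoeff p.2 (b + 1) := by
  induction k with
  | zero => intro a b _ _; simp [hCoeff_zero]
  | succ k ih =>
    intro a b ha hb
    have e1 : ∑ p ∈ antidiagonal (k + 1), hCoeff p.1 (a + 1) * hCoeff p.2 b =
        ∑ p ∈ antidiagonal (k + 1), hCoeff p.1 a * hCoeff p.2 b +
          ∑ p ∈ antidiagonal k, hCoeff p.1 (a + 2) * hCoeff p.2 b := by
      rw [Nat.sum_antidiagonal_succ, Nat.sum_antidiagonal_succ, add_assoc, ← sum_add_distrib]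
      simp only [hCoeff_zero]
      congr 1
      refine sum_congr rfl fun p _ => ?_
      rw [← hCoeff_succ_add_one_sub ha]; ring
    have e2 : ∑ p ∈ antidiagonal (k + 1), hCoeff p.1 a * hCoeff p.2 (b + 1) =
        ∑ p ∈ antidiagonal (k + 1), hCoeff p.1 a * hCoeff p.2 b +
          ∑ p ∈ antidiagonal k, hCoeff p.1 a * hCoeff p.2 (b + 2) := by
      rw [Nat.sum_antidiagonal_succ', Nat.sum_antidiagonal_succ', add_assoc, ← sum_add_distrib]
      simp only [hCoeff_zero]
      congr 1
      refine sum_congr rfl fun p _ => ?_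
      rw [← hCoeff_succ_add_one_sub hb]; ring
    -- The remainders agree in degree `k`: two shifts move the 2 across, `C^(a+2) C^b = C^(a+1)
    -- C^(b+1) = C^a C^(b+2)`.
    rw [e1, e2, show a + 2 = a + 1 + 1 by ring, ih (by linarith) hb, ih ha (by linarith),
      show b + 1 + 1 = b + 2 by ring]

/-! ### Zero-sum families and single sign changes -/

/-- A weighted sum of a zero-sum family is non-negative when the weight is larger on the positive
terms than on the negative ones. -/
lemma sum_mul_nonneg_of_sum_eq_zero {ι : Type*} (s : Finset ι) (w M : ι → ℝ)
    (hM : ∑ i ∈ s, M i = 0)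
    (hw : ∀ i ∈ s, ∀ j ∈ s, 0 < M i → M j < 0 → w j ≤ w i) : 0 ≤ ∑ i ∈ s, w i * M i := by
  by_cases hpos : ∃ i ∈ s, 0 < M i
  · obtain ⟨m, hm, hmin⟩ := exists_min_image (s.filter fun i => 0 < M i) w
      (by obtain ⟨i, hi, h⟩ := hpos; exact ⟨i, mem_filter.2 ⟨hi, h⟩⟩)
    -- The least weight `w m` on the positive terms is a threshold: replacing every weight by it can
    -- only lower the sum, and gives 0.
    rw [mem_filter] at hm
    have : ∑ i ∈ s, w m * M i ≤ ∑ i ∈ s, w i * M i := by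
      refine sum_le_sum fun i hi => ?_
      rcases lt_trichotomy (M i) 0 with h | h | h
      · nlinarith [hw m hm.1 i hi hm.2 h]
      · simp [h]
      · nlinarith [hmin i (mem_filter.2 ⟨hi, h⟩)]
    rwa [← mul_sum, hM, mul_zero] at this
  · push Not at hpos
    have h0 := (sum_eq_zero_iff_of_nonpos hpos).1 hM
    rw [sum_eq_zero fun i hi => by rw [h0 i hi, mul_zero]]

/-- A quartic whose coefficients change sign once stays non-negative beyond any point where it is
positive. -/
lemma quartic_nonneg_of_le {c₀ c₁ c₂ c₃ c₄ p q : ℝ} (h0 : c₀ ≤ 0) (h12 : 0 ≤ c₂ ∨ c₁ ≤ 0)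
    (h3 : 0 ≤ c₃) (h4 : 0 ≤ c₄) (hp : 0 ≤ p) (hpq : p ≤ q)
    (hP : 0 < c₀ + c₁ * p + c₂ * p ^ 2 + c₃ * p ^ 3 + c₄ * p ^ 4) :
    0 ≤ c₀ + c₁ * q + c₂ * q ^ 2 + c₃ * q ^ 3 + c₄ * q ^ 4 := by
  rcases hp.eq_or_lt with rfl | hp
  · simp at hP; linarith
  have hq : 0 < q := by linarith
  obtain ⟨r, rfl⟩ : ∃ r, q = p + r := ⟨q - p, by ring⟩
  have hr : 0 ≤ r := by linarith
  rcases h12 with h2 | h1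
  -- If `c₂ ≥ 0`, then `P(x) / x` is non-decreasing for `x > 0`; if `c₁ ≤ 0`, then `P(x) / x ^ 2`
  -- is. The identities below are these facts with denominators cleared.
  · have key : 0 ≤ p * (c₀ + c₁ * (p + r) + c₂ * (p + r) ^ 2 + c₃ * (p + r) ^ 3 +
        c₄ * (p + r) ^ 4) := by
      have e : p * (c₀ + c₁ * (p + r) + c₂ * (p + r) ^ 2 + c₃ * (p + r) ^ 3 + c₄ * (p + r) ^ 4) =
          (p + r) * (c₀ + c₁ * p + c₂ * p ^ 2 + c₃ * p ^ 3 + c₄ * p ^ 4) + (-c₀) * r +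
          p * (p + r) * r * (c₂ + c₃ * (2 * p + r) + c₄ * (3 * p ^ 2 + 3 * p * r + r ^ 2)) := by
        ring
      rw [e]
      have : 0 ≤ -c₀ := by linarith
      positivity
    exact nonneg_of_mul_nonneg_right key hp
  · have key : 0 ≤ p ^ 2 * (c₀ + c₁ * (p + r) + c₂ * (p + r) ^ 2 + c₃ * (p + r) ^ 3 +
        c₄ * (p + r) ^ 4) := by
      have e : p ^ 2 * (c₀ + c₁ * (p + r) + c₂ * (p + r) ^ 2 + c₃ * (p + r) ^ 3 +
          c₄ * (p + r) ^ 4) =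
          (p + r) ^ 2 * (c₀ + c₁ * p + c₂ * p ^ 2 + c₃ * p ^ 3 + c₄ * p ^ 4) +
          (-c₀) * r * (2 * p + r) + (-c₁) * p * (p + r) * r +
          p ^ 2 * (p + r) ^ 2 * r * (c₃ + c₄ * (2 * p + r)) := by
        ring
      rw [e]
      have : 0 ≤ -c₀ := by linarith
      have : 0 ≤ -c₁ := by linarith
      positivity
    exact nonneg_of_mul_nonneg_right key (by positivity)

/-! ### Sign change of the symmetrized terms for gaps 1, 2, 3 -/

/-- The symmetrized term of the convolution whose sum vanishes by `sum_hCoeff_shift`. -/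
noncomputable def shiftTerm (a b : ℝ) (i l : ℕ) : ℝ :=
  (hCoeff i (a + 1) * hCoeff l b - hCoeff i a * hCoeff l (b + 1)) +
    (hCoeff l (a + 1) * hCoeff i b - hCoeff l a * hCoeff i (b + 1))

/-- On each antidiagonal, a positive term of `shiftTerm a b` has a larger product of indices than
a negative one. -/
def ShiftTermSignChange (a b : ℝ) : Prop :=
  ∀ i l i' l' : ℕ, i + l = i' + l' → 0 < shiftTerm a b i l → shiftTerm a b i' l' < 0 →
    i' * l' ≤ i * l

lemma shiftTermSignChange_of_quartic {a b : ℝ} (K : ℕ → ℕ → ℝ) (hK : ∀ i l, 0 < K i l)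
    (c₀ c₁ c₂ c₃ c₄ : ℕ → ℝ) (h0 : ∀ k, c₀ k ≤ 0) (h12 : ∀ k, 0 ≤ c₂ k ∨ c₁ k ≤ 0)
    (h3 : ∀ k, 0 ≤ c₃ k) (h4 : ∀ k, 0 ≤ c₄ k)
    (hM : ∀ i l : ℕ, shiftTerm a b i l = K i l * (c₀ (i + l) + c₁ (i + l) * ((i : ℝ) * l) +
      c₂ (i + l) * ((i : ℝ) * l) ^ 2 + c₃ (i + l) * ((i : ℝ) * l) ^ 3 +
      c₄ (i + l) * ((i : ℝ) * l) ^ 4)) : ShiftTermSignChange a b := by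
  intro i l i' l' hk hpos hneg
  by_contra! hlt
  rw [hM] at hpos hneg
  have h1 := pos_of_mul_pos_right hpos (hK i l).le
  have h2 : ((i : ℝ) * l) ≤ (i' : ℝ) * l' := by exact_mod_cast hlt.le
  have h3 := quartic_nonneg_of_le (h0 _) (h12 _) (h3 _) (h4 _) (by positivity) h2 h1
  rw [hk] at h3
  exact absurd hneg (not_lt.2 (mul_nonneg (hK i' l').le h3))

lemma shiftTermSignChange_add_one {a : ℝ} (ha : 0 < a) : ShiftTermSignChange a (a + 1) := by
  refine shiftTermSignChange_of_quartic
    -- Iterating `hCoeff_add_one` writes each coefficient as a rational multiple of that at `a`;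
    -- this is the factor left after clearing denominators. The same holds for the other gaps.
    (fun i l => hCoeff i a * hCoeff l a / (a ^ 2 * ((a + i + 1) * (a + l + 1) * (a + i + 2) * (a
    + l + 2))))
    (fun i l => ?_)
    (fun k => 8 * a * (k : ℝ) - 8 * a * (k : ℝ) ^ 2 + 14 * a ^ 2 * (k : ℝ) - 14 * a ^ 2 * (k :
    ℝ) ^ 2 + 7 * a ^ 3 * (k : ℝ) - 7 * a ^ 3 * (k : ℝ) ^ 2 + 1 * a ^ 4 * (k : ℝ) - 1 * a ^ 4 *
    (k : ℝ) ^ 2)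
    (fun k => 32 + 16 * (k : ℝ) + 104 * a + 16 * a * (k : ℝ) + 98 * a ^ 2 + 2 * a ^ 2 * (k : ℝ)
    + 34 * a ^ 3 + 4 * a ^ 4)
    (fun k => 8)
    (fun k => 0)
    (fun k => 0)
    (fun k => ?_) (fun k => ?_) (fun k => ?_) (fun k => ?_) (fun i l => ?_)
  · have := hCoeff_pos ha i
    have := hCoeff_pos ha l
    positivity
  · cases k with
    | zero => simp
    -- With `k = t + 1`, the expansion of `-c₀` has only positive coefficients in `a` and `t`.
    | succ t =>
      push_cast
      rw [← neg_nonneg]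
      have e : 0 ≤
          8 * a * (t : ℝ) + 8 * a * (t : ℝ) ^ 2 + 14 * a ^ 2 * (t : ℝ) + 14 * a ^ 2 * (t : ℝ) ^
          2 + 7 * a ^ 3 * (t : ℝ) + 7 * a ^ 3 * (t : ℝ) ^ 2 + 1 * a ^ 4 * (t : ℝ) + 1 * a ^ 4 *
          (t : ℝ) ^ 2 := by
        positivity
      convert e using 1
      ring
  · left
    positivity
  · positivity
  · positivity
  · unfold shiftTerm
    simp only [hCoeff_add_one (by linarith : 0 < a + 1),
      hCoeff_add_one ha]
    push_cast
    field_simp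
    ring

lemma shiftTermSignChange_add_two {a : ℝ} (ha : 0 < a) : ShiftTermSignChange a (a + 2) := by
  refine shiftTermSignChange_of_quartic
    (fun i l => hCoeff i a * hCoeff l a / (a ^ 2 * ((a + i + 1) * (a + l + 1) * (a + i + 2) * (a
    + l + 2) * (a + i + 3) * (a + l + 3))))
    (fun i l => ?_)
    (fun k => 72 * a * (k : ℝ) + 12 * a * (k : ℝ) ^ 2 - 84 * a * (k : ℝ) ^ 3 + 204 * a ^ 2 * (k
    : ℝ) - 32 * a ^ 2 * (k : ℝ) ^ 2 - 172 * a ^ 2 * (k : ℝ) ^ 3 + 216 * a ^ 3 * (k : ℝ) - 99 * a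
    ^ 3 * (k : ℝ) ^ 2 - 117 * a ^ 3 * (k : ℝ) ^ 3 + 106 * a ^ 4 * (k : ℝ) - 74 * a ^ 4 * (k : ℝ)
    ^ 2 - 32 * a ^ 4 * (k : ℝ) ^ 3 + 24 * a ^ 5 * (k : ℝ) - 21 * a ^ 5 * (k : ℝ) ^ 2 - 3 * a ^ 5
    * (k : ℝ) ^ 3 + 2 * a ^ 6 * (k : ℝ) - 2 * a ^ 6 * (k : ℝ) ^ 2)
    (fun k => 288 + 456 * (k : ℝ) + 120 * (k : ℝ) ^ 2 + 1224 * a + 1440 * a * (k : ℝ) + 84 * a *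
    (k : ℝ) ^ 2 + 1896 * a ^ 2 + 1568 * a ^ 2 * (k : ℝ) - 34 * a ^ 2 * (k : ℝ) ^ 2 + 1440 * a ^
    3 + 738 * a ^ 3 * (k : ℝ) - 30 * a ^ 3 * (k : ℝ) ^ 2 + 564 * a ^ 4 + 154 * a ^ 4 * (k : ℝ) -
    4 * a ^ 4 * (k : ℝ) ^ 2 + 108 * a ^ 5 + 12 * a ^ 5 * (k : ℝ) + 8 * a ^ 6)
    (fun k => 320 + 136 * (k : ℝ) + 840 * a + 96 * a * (k : ℝ) + 616 * a ^ 2 + 8 * a ^ 2 * (k :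
    ℝ) + 168 * a ^ 3 + 16 * a ^ 4)
    (fun k => 32)
    (fun k => 0)
    (fun k => ?_) (fun k => ?_) (fun k => ?_) (fun k => ?_) (fun i l => ?_)
  · have := hCoeff_pos ha i
    have := hCoeff_pos ha l
    positivity
  · cases k with
    | zero => simp
    | succ t =>
      push_cast
      rw [← neg_nonneg]
      have e : 0 ≤
          156 * a * (t : ℝ) + 240 * a * (t : ℝ) ^ 2 + 84 * a * (t : ℝ) ^ 3 + 376 * a ^ 2 * (t :
          ℝ) + 548 * a ^ 2 * (t : ℝ) ^ 2 + 172 * a ^ 2 * (t : ℝ) ^ 3 + 333 * a ^ 3 * (t : ℝ) +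
          450 * a ^ 3 * (t : ℝ) ^ 2 + 117 * a ^ 3 * (t : ℝ) ^ 3 + 138 * a ^ 4 * (t : ℝ) + 170 *
          a ^ 4 * (t : ℝ) ^ 2 + 32 * a ^ 4 * (t : ℝ) ^ 3 + 27 * a ^ 5 * (t : ℝ) + 30 * a ^ 5 *
          (t : ℝ) ^ 2 + 3 * a ^ 5 * (t : ℝ) ^ 3 + 2 * a ^ 6 * (t : ℝ) + 2 * a ^ 6 * (t : ℝ) ^ 2 := by
        positivity
      convert e using 1
      ring
  · left
    positivity
  · positivity
  · positivity
  · unfold shiftTerm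
    rw [show a + 2 + 1 = a + 1 + 1 + 1 by ring, show a + 2 = a + 1 + 1 by ring]
    simp only [hCoeff_add_one (by linarith : 0 < a + 1 + 1),
      hCoeff_add_one (by linarith : 0 < a + 1),
      hCoeff_add_one ha]
    push_cast
    field_simp
    ring

set_option maxHeartbeats 2000000 in
lemma shiftTermSignChange_add_three {a : ℝ} (ha : 0 < a) : ShiftTermSignChange a (a + 3) := by
  refine shiftTermSignChange_of_quartic
    (fun i l => hCoeff i a * hCoeff l a / (a ^ 2 * ((a + i + 1) * (a + l + 1) * (a + i + 2) * (a
    + l + 2) * (a + i + 3) * (a + l + 3) * (a + i + 4) * (a + l + 4))))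
    (fun i l => ?_)
    (fun k => 1152 * a * (k : ℝ) + 768 * a * (k : ℝ) ^ 2 - 1008 * a * (k : ℝ) ^ 3 - 912 * a * (k
    : ℝ) ^ 4 + 3984 * a ^ 2 * (k : ℝ) + 1552 * a ^ 2 * (k : ℝ) ^ 2 - 3468 * a ^ 2 * (k : ℝ) ^ 3
    - 2068 * a ^ 2 * (k : ℝ) ^ 4 + 5628 * a ^ 3 * (k : ℝ) + 588 * a ^ 3 * (k : ℝ) ^ 2 - 4536 * a
    ^ 3 * (k : ℝ) ^ 3 - 1680 * a ^ 3 * (k : ℝ) ^ 4 + 4212 * a ^ 4 * (k : ℝ) - 722 * a ^ 4 * (k :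
    ℝ) ^ 2 - 2865 * a ^ 4 * (k : ℝ) ^ 3 - 625 * a ^ 4 * (k : ℝ) ^ 4 + 1803 * a ^ 5 * (k : ℝ) -
    768 * a ^ 5 * (k : ℝ) ^ 2 - 927 * a ^ 5 * (k : ℝ) ^ 3 - 108 * a ^ 5 * (k : ℝ) ^ 4 + 441 * a
    ^ 6 * (k : ℝ) - 287 * a ^ 6 * (k : ℝ) ^ 2 - 147 * a ^ 6 * (k : ℝ) ^ 3 - 7 * a ^ 6 * (k : ℝ)
    ^ 4 + 57 * a ^ 7 * (k : ℝ) - 48 * a ^ 7 * (k : ℝ) ^ 2 - 9 * a ^ 7 * (k : ℝ) ^ 3 + 3 * a ^ 8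
    * (k : ℝ) - 3 * a ^ 8 * (k : ℝ) ^ 2)
    (fun k => 4608 + 9984 * (k : ℝ) + 7200 * (k : ℝ) ^ 2 + 1248 * (k : ℝ) ^ 3 + 22848 * a +
    38976 * a * (k : ℝ) + 19596 * a * (k : ℝ) ^ 2 + 612 * a * (k : ℝ) ^ 3 + 43592 * a ^ 2 +
    59814 * a ^ 2 * (k : ℝ) + 20936 * a ^ 2 * (k : ℝ) ^ 2 - 1026 * a ^ 2 * (k : ℝ) ^ 3 + 44196 *
    a ^ 3 + 47619 * a ^ 3 * (k : ℝ) + 10797 * a ^ 3 * (k : ℝ) ^ 2 - 870 * a ^ 3 * (k : ℝ) ^ 3 +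
    26516 * a ^ 4 + 21243 * a ^ 4 * (k : ℝ) + 2807 * a ^ 4 * (k : ℝ) ^ 2 - 222 * a ^ 4 * (k : ℝ)
    ^ 3 + 9678 * a ^ 5 + 5301 * a ^ 5 * (k : ℝ) + 351 * a ^ 5 * (k : ℝ) ^ 2 - 18 * a ^ 5 * (k :
    ℝ) ^ 3 + 2096 * a ^ 6 + 687 * a ^ 6 * (k : ℝ) + 17 * a ^ 6 * (k : ℝ) ^ 2 + 246 * a ^ 7 + 36
    * a ^ 7 * (k : ℝ) + 12 * a ^ 8)
    (fun k => 1824 + 5928 * (k : ℝ) + 1560 * (k : ℝ) ^ 2 + 12096 * a + 16620 * a * (k : ℝ) +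
    1176 * a * (k : ℝ) ^ 2 + 18680 * a ^ 2 + 15450 * a ^ 2 * (k : ℝ) + 48 * a ^ 2 * (k : ℝ) ^ 2
    + 12762 * a ^ 3 + 6144 * a ^ 3 * (k : ℝ) - 96 * a ^ 3 * (k : ℝ) ^ 2 + 4316 * a ^ 4 + 1086 *
    a ^ 4 * (k : ℝ) - 12 * a ^ 4 * (k : ℝ) ^ 2 + 702 * a ^ 5 + 72 * a ^ 5 * (k : ℝ) + 44 * a ^
    6)
    (fun k => 1632 + 696 * (k : ℝ) + 4152 * a + 384 * a * (k : ℝ) + 2616 * a ^ 2 + 24 * a ^ 2 *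
    (k : ℝ) + 600 * a ^ 3 + 48 * a ^ 4)
    (fun k => 96)
    (fun k => ?_) (fun k => ?_) (fun k => ?_) (fun k => ?_) (fun i l => ?_)
  · have := hCoeff_pos ha i
    have := hCoeff_pos ha l
    positivity
  · cases k with
    | zero => simp
    | succ t =>
      push_cast
      rw [← neg_nonneg]
      have e : 0 ≤
          3984 * a * (t : ℝ) + 7728 * a * (t : ℝ) ^ 2 + 4656 * a * (t : ℝ) ^ 3 + 912 * a * (t :
          ℝ) ^ 4 + 11588 * a ^ 2 * (t : ℝ) + 21260 * a ^ 2 * (t : ℝ) ^ 2 + 11740 * a ^ 2 * (t :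
          ℝ) ^ 3 + 2068 * a ^ 2 * (t : ℝ) ^ 4 + 13524 * a ^ 3 * (t : ℝ) + 23100 * a ^ 3 * (t :
          ℝ) ^ 2 + 11256 * a ^ 3 * (t : ℝ) ^ 3 + 1680 * a ^ 3 * (t : ℝ) ^ 4 + 8327 * a ^ 4 * (t
          : ℝ) + 13067 * a ^ 4 * (t : ℝ) ^ 2 + 5365 * a ^ 4 * (t : ℝ) ^ 3 + 625 * a ^ 4 * (t :
          ℝ) ^ 4 + 2946 * a ^ 5 * (t : ℝ) + 4197 * a ^ 5 * (t : ℝ) ^ 2 + 1359 * a ^ 5 * (t : ℝ)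
          ^ 3 + 108 * a ^ 5 * (t : ℝ) ^ 4 + 602 * a ^ 6 * (t : ℝ) + 770 * a ^ 6 * (t : ℝ) ^ 2 +
          175 * a ^ 6 * (t : ℝ) ^ 3 + 7 * a ^ 6 * (t : ℝ) ^ 4 + 66 * a ^ 7 * (t : ℝ) + 75 * a ^
          7 * (t : ℝ) ^ 2 + 9 * a ^ 7 * (t : ℝ) ^ 3 + 3 * a ^ 8 * (t : ℝ) + 3 * a ^ 8 * (t : ℝ)
          ^ 2 := by
        positivity
      convert e using 1
      ring
  -- Both `c₁` and `c₂` have negative monomials here. With `Q = a ^ 2 + a * k + k + 3`, the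
  -- difference `Q * c₂ - c₁` has only positive coefficients, so `c₂ < 0` forces `c₁ < 0`.
  · refine or_iff_not_imp_left.2 fun h => ?_
    push Not at h
    have hQ : 0 < a ^ 2 + a * (k : ℝ) + k + 3 := by positivity
    have e : 0 ≤
        864 + 9624 * (k : ℝ) + 3408 * (k : ℝ) ^ 2 + 312 * (k : ℝ) ^ 3 + 13440 * a + 24804 * a *
        (k : ℝ) + 6480 * a * (k : ℝ) ^ 2 + 2124 * a * (k : ℝ) ^ 3 + 14272 * a ^ 2 + 23240 * a ^
        2 * (k : ℝ) + 12838 * a ^ 2 * (k : ℝ) ^ 2 + 2250 * a ^ 2 * (k : ℝ) ^ 3 + 6186 * a ^ 3 +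
        18875 * a ^ 3 * (k : ℝ) + 11685 * a ^ 3 * (k : ℝ) ^ 2 + 822 * a ^ 3 * (k : ℝ) ^ 3 + 5112
        * a ^ 4 + 14543 * a ^ 4 * (k : ℝ) + 4435 * a ^ 4 * (k : ℝ) ^ 2 + 114 * a ^ 4 * (k : ℝ) ^
        3 + 5190 * a ^ 5 + 6077 * a ^ 5 * (k : ℝ) + 711 * a ^ 5 * (k : ℝ) ^ 2 + 6 * a ^ 5 * (k :
        ℝ) ^ 3 + 2352 * a ^ 6 + 1145 * a ^ 6 * (k : ℝ) + 43 * a ^ 6 * (k : ℝ) ^ 2 + 456 * a ^ 7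
        + 80 * a ^ 7 * (k : ℝ) + 32 * a ^ 8 := by
      positivity
    nlinarith only [mul_neg_of_pos_of_neg hQ h, e]
  · positivity
  · positivity
  · unfold shiftTerm
    rw [show a + 3 + 1 = a + 1 + 1 + 1 + 1 by ring, show a + 3 = a + 1 + 1 + 1 by ring]
    simp only [hCoeff_add_one (by linarith : 0 < a + 1 + 1 + 1),
      hCoeff_add_one (by linarith : 0 < a + 1 + 1),
      hCoeff_add_one (by linarith : 0 < a + 1),
      hCoeff_add_one ha]
    push_cast
    field_simp
    ring

lemma sum_mul_shiftTerm_nonneg {a b : ℝ} (ha : 0 < a) (hb : 0 < b)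
    (hs : ShiftTermSignChange a b) (k : ℕ) (w : ℕ → ℕ → ℝ)
    (hw : ∀ i l i' l', i + l = i' + l' → i' * l' ≤ i * l → w i' l' ≤ w i l) :
    0 ≤ ∑ p ∈ antidiagonal k, w p.1 p.2 *
      (hCoeff p.1 (a + 1) * hCoeff p.2 b - hCoeff p.1 a * hCoeff p.2 (b + 1)) := by
  have hsum : ∑ p ∈ antidiagonal k,
      (hCoeff p.1 (a + 1) * hCoeff p.2 b - hCoeff p.1 a * hCoeff p.2 (b + 1)) = 0 := by
    rw [sum_sub_distrib, sum_hCoeff_shift k ha hb, sub_self]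
  -- Swapping indices preserves sum and product, so monotonicity in both directions forces a
  -- symmetric weight. Symmetrizing then just doubles the sum.
  have hsymm : ∀ i l, w i l = w l i := fun i l =>
    le_antisymm (hw _ _ _ _ (add_comm _ _) (mul_comm _ _).le)
      (hw _ _ _ _ (add_comm _ _) (mul_comm _ _).le)
  have h := sum_mul_nonneg_of_sum_eq_zero (antidiagonal k) (fun p => w p.1 p.2)
    (fun p => shiftTerm a b p.1 p.2) (by
      simp only [shiftTerm]
      rw [sum_add_distrib, hsum, zero_add, ← hsum]
      exact Nat.sum_antidiagonal_swap
        (f := fun p => hCoeff p.1 (a + 1) * hCoeff p.2 b - hCoeff p.1 a * hCoeff p.2 (b + 1)))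
    (by
      rintro ⟨i, l⟩ hi ⟨i', l'⟩ hi' hpos hneg
      rw [HasAntidiagonal.mem_antidiagonal] at hi hi'
      exact hw _ _ _ _ (hi.trans hi'.symm) (hs _ _ _ _ (hi.trans hi'.symm) hpos hneg))
  have e : ∑ p ∈ antidiagonal k, w p.1 p.2 * shiftTerm a b p.1 p.2 =
      2 * ∑ p ∈ antidiagonal k, w p.1 p.2 *
        (hCoeff p.1 (a + 1) * hCoeff p.2 b - hCoeff p.1 a * hCoeff p.2 (b + 1)) := by
    simp only [shiftTerm, mul_add]
    rw [sum_add_distrib, two_mul]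
    congr 1
    rw [← Nat.sum_antidiagonal_swap]
    exact sum_congr rfl fun p _ => by rw [Prod.fst_swap, Prod.snd_swap, hsymm]
  linarith [e ▸ h]

/-! ### Coefficients of the Turanian -/

lemma coeff_hSeries (h : ℕ → ℝ) (a : ℝ) (k : ℕ) :
    PowerSeries.coeff k (hSeries h a) = h k * hCoeff k a := by
  simp [hSeries, hCoeff]

lemma coeff_hSeries_mul (h : ℕ → ℝ) (a b : ℝ) (k : ℕ) :
    PowerSeries.coeff k (hSeries h a * hSeries h b) =
      ∑ p ∈ antidiagonal k, h p.1 * h p.2 * (hCoeff p.1 a * hCoeff p.2 b) := by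
  rw [PowerSeries.coeff_mul]
  refine sum_congr rfl fun p _ => ?_
  rw [coeff_hSeries, coeff_hSeries]; ring

/-- The difference of the coefficients of `h(a+1; x) h(b; x)` and `h(a; x) h(b+1; x)`, for
`b = a + d`. -/
noncomputable def shiftDefect (h : ℕ → ℝ) (d a : ℝ) (k : ℕ) : ℝ :=
  PowerSeries.coeff k (hSeries h (a + 1) * hSeries h (a + d)) -
    PowerSeries.coeff k (hSeries h a * hSeries h (a + d + 1))

lemma shiftDefect_eq_sum (h : ℕ → ℝ) (d a : ℝ) (k : ℕ) :
    shiftDefect h d a k = ∑ p ∈ antidiagonal k, h p.1 * h p.2 *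
      (hCoeff p.1 (a + 1) * hCoeff p.2 (a + d) - hCoeff p.1 a * hCoeff p.2 (a + d + 1)) := by
  rw [shiftDefect, coeff_hSeries_mul, coeff_hSeries_mul, ← sum_sub_distrib]
  exact sum_congr rfl fun p _ => by ring

lemma continuousAt_shiftDefect_zero (h : ℕ → ℝ) {d : ℝ} (hd : 0 ≤ d) (k : ℕ) :
    ContinuousAt (fun a => shiftDefect h d a k) 0 := by
  simp only [shiftDefect_eq_sum]
  have key : ∀ (i : ℕ) (c : ℝ), 0 ≤ c → ContinuousAt (fun a : ℝ => hCoeff i (a + c)) 0 :=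
    fun i c hc => ContinuousAt.comp (f := fun a : ℝ => a + c) (g := hCoeff i)
      (continuousAt_hCoeff (by simpa using hc) i) (by fun_prop)
  refine tendsto_finsetSum _ fun p _ => ?_
  have h0 := key p.1 0 le_rfl
  simp only [add_zero] at h0
  have h3 := key p.2 (d + 1) (by linarith)
  simp only [← add_assoc] at h3
  exact (((key p.1 1 zero_le_one).mul (key p.2 d hd)).sub (h0.mul h3)).const_mul (h p.1 * h p.2)

/-- The gaps `d` for which the coefficients of `h(a+1; x) h(a+d; x) - h(a; x) h(a+d+1; x)` are
controlled by `ShiftTermSignChange`. -/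
def HasShiftSignChange (d : ℝ) : Prop := 0 ≤ d ∧ ∀ a : ℝ, 0 < a → ShiftTermSignChange a (a + d)

/-- The products `h i * h l` with `i + l` fixed increase with `i * l`. -/
def ProductsMono (h : ℕ → ℝ) : Prop :=
  ∀ i l i' l', i + l = i' + l' → i' * l' ≤ i * l → h i' * h l' ≤ h i * h l

/-- The products `h i * h l` with `i + l` fixed decrease with `i * l`. -/
def ProductsAnti (h : ℕ → ℝ) : Prop :=
  ∀ i l i' l', i + l = i' + l' → i' * l' ≤ i * l → h i * h l ≤ h i' * h l'

/-- Recovers `μ = 0`, which the arguments above exclude by dividing by `a`. -/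
lemma nonneg_of_continuousAt_zero {f : ℝ → ℝ} (hf : ContinuousAt f 0)
    (hpos : ∀ a, 0 < a → 0 ≤ f a) {a : ℝ} (ha : 0 ≤ a) : 0 ≤ f a := by
  rcases ha.eq_or_lt with rfl | ha
  · exact ge_of_tendsto (hf.tendsto.mono_left (nhdsWithin_le_nhds (s := Set.Ioi 0)))
      (eventually_mem_nhdsWithin.mono hpos)
  · exact hpos a ha

lemma shiftDefect_nonneg {h : ℕ → ℝ} (hh : ProductsMono h) {d a : ℝ} (hd : HasShiftSignChange d)
    (ha : 0 ≤ a) (k : ℕ) : 0 ≤ shiftDefect h d a k := by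
  refine nonneg_of_continuousAt_zero (continuousAt_shiftDefect_zero h hd.1 k) (fun a ha => ?_) ha
  rw [shiftDefect_eq_sum]
  exact sum_mul_shiftTerm_nonneg ha (by linarith [hd.1]) (hd.2 a ha) k (fun i l => h i * h l) hh

lemma shiftDefect_nonpos {h : ℕ → ℝ} (hh : ProductsAnti h) {d a : ℝ} (hd : HasShiftSignChange d)
    (ha : 0 ≤ a) (k : ℕ) : shiftDefect h d a k ≤ 0 := by
  rw [← neg_nonneg]
  refine nonneg_of_continuousAt_zero (continuousAt_shiftDefect_zero h hd.1 k).neg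
    (fun a ha => ?_) ha
  have := sum_mul_shiftTerm_nonneg ha (by linarith [hd.1]) (hd.2 a ha) k
    (fun i l => -(h i * h l)) fun i l i' l' e1 e2 => neg_le_neg (hh i l i' l' e1 e2)
  rw [Pi.neg_apply, shiftDefect_eq_sum]
  simpa only [neg_mul, sum_neg_distrib] using this

lemma hasShiftSignChange_one : HasShiftSignChange 1 :=
  ⟨by norm_num, fun _ ha => shiftTermSignChange_add_one ha⟩

lemma hasShiftSignChange_two : HasShiftSignChange 2 :=
  ⟨by norm_num, fun _ ha => shiftTermSignChange_add_two ha⟩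

lemma hasShiftSignChange_three : HasShiftSignChange 3 :=
  ⟨by norm_num, fun _ ha => shiftTermSignChange_add_three ha⟩

lemma formalTuranian_comm (f : ℝ → PowerSeries ℝ) (μ α β : ℝ) :
    formalTuranian f μ α β = formalTuranian f μ β α := by
  rw [formalTuranian, formalTuranian, mul_comm, add_right_comm]

lemma coeff_formalTuranian_one (h : ℕ → ℝ) (μ d : ℝ) (k : ℕ) :
    PowerSeries.coeff k (formalTuranian (hSeries h) μ 1 d) = shiftDefect h d μ k := by
  rw [formalTuranian, shiftDefect, map_sub, add_right_comm]

/-- Telescoping through the product `h(μ+1) h(μ+3)`. -/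
lemma coeff_formalTuranian_two (h : ℕ → ℝ) (μ : ℝ) (k : ℕ) :
    PowerSeries.coeff k (formalTuranian (hSeries h) μ 2 2) =
      shiftDefect h 1 (μ + 1) k + shiftDefect h 3 μ k := by
  rw [formalTuranian, shiftDefect, shiftDefect, map_sub]
  rw [show μ + 1 + 1 = μ + 2 by ring, show μ + 2 + 1 = μ + 3 by ring,
    show μ + 3 + 1 = μ + 2 + 2 by ring]
  ring

/-- Every Turanian with `α + β ≤ 4` has coefficients that are sums of values of `shiftDefect`. -/
lemma coeff_formalTuranian_induction {h : ℕ → ℝ} {k : ℕ} {P : ℝ → Prop}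
    (hadd : ∀ x y, P x → P y → P (x + y))
    (hP : ∀ d a : ℝ, HasShiftSignChange d → 0 ≤ a → P (shiftDefect h d a k))
    {μ : ℝ} (hμ : 0 ≤ μ) {α β : ℕ} (hα : 1 ≤ α) (hβ : 1 ≤ β) (hαβ : α + β ≤ 4) :
    P (PowerSeries.coeff k (formalTuranian (hSeries h) μ α β)) := by
  have h1 : ∀ d, HasShiftSignChange d →
      P (PowerSeries.coeff k (formalTuranian (hSeries h) μ 1 d)) := fun d hd => by
    rw [coeff_formalTuranian_one]; exact hP d μ hd hμ
  have h1' : ∀ d, HasShiftSignChange d →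
      P (PowerSeries.coeff k (formalTuranian (hSeries h) μ d 1)) := fun d hd => by
    rw [formalTuranian_comm]; exact h1 d hd
  have h2 : P (PowerSeries.coeff k (formalTuranian (hSeries h) μ 2 2)) := by
    rw [coeff_formalTuranian_two]
    exact hadd _ _ (hP _ _ hasShiftSignChange_one (by linarith))
      (hP _ _ hasShiftSignChange_three hμ)
  have hcases : (α = 1 ∧ β = 1) ∨ (α = 1 ∧ β = 2) ∨ (α = 1 ∧ β = 3) ∨ (α = 2 ∧ β = 1) ∨
      (α = 2 ∧ β = 2) ∨ (α = 3 ∧ β = 1) := by lia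
  rcases hcases with ⟨rfl, rfl⟩ | ⟨rfl, rfl⟩ | ⟨rfl, rfl⟩ | ⟨rfl, rfl⟩ | ⟨rfl, rfl⟩ | ⟨rfl, rfl⟩
  · simpa using h1 1 hasShiftSignChange_one
  · simpa using h1 2 hasShiftSignChange_two
  · simpa using h1 3 hasShiftSignChange_three
  · simpa using h1' 2 hasShiftSignChange_two
  · simpa using h2
  · simpa using h1' 3 hasShiftSignChange_three

/-! ### From consecutive inequalities to nested pairs of indices -/

/-- Successive ratios decrease. An interior zero would block the division, so `hs` makes the left
side vanish there. The bound `N` allows use on series known to converge only up to a given shift. -/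
lemma mul_le_mul_of_logConcave {f : ℕ → ℝ} {N : ℕ} (h0 : ∀ n, 0 ≤ f n)
    (hf : ∀ n, n + 2 ≤ N → f n * f (n + 2) ≤ f (n + 1) ^ 2)
    (hs : ∀ j m l, j ≤ m → m ≤ l → l ≤ N → f m = 0 → f j * f l = 0) {j l : ℕ} (hjl : j ≤ l)
    (hl : l + 1 ≤ N) : f j * f (l + 1) ≤ f (j + 1) * f l := by
  induction l, hjl using Nat.le_induction with
  | base => exact (mul_comm _ _).le
  | succ l hjl ih =>
    have ih := ih (by lia)
    have h2 := hf l hl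
    rcases (h0 l).eq_or_lt with h | h
    · rw [hs j l (l + 1 + 1) hjl (by lia) hl h.symm]
      exact mul_nonneg (h0 _) (h0 _)
    · refine le_of_mul_le_mul_right ?_ h
      calc f j * f (l + 1 + 1) * f l = f j * (f l * f (l + 2)) := by ring
        _ ≤ f j * f (l + 1) ^ 2 := mul_le_mul_of_nonneg_left h2 (h0 j)
        _ = f j * f (l + 1) * f (l + 1) := by ring
        _ ≤ f (j + 1) * f l * f (l + 1) := mul_le_mul_of_nonneg_right ih (h0 _)
        _ = f (j + 1) * f (l + 1) * f l := by ring

lemma mul_le_mul_of_logConvex {f : ℕ → ℝ} {N : ℕ} (h0 : ∀ n, 0 ≤ f n)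
    (hf : ∀ n, n + 2 ≤ N → f (n + 1) ^ 2 ≤ f n * f (n + 2)) {j l : ℕ} (hjl : j ≤ l)
    (hl : l + 1 ≤ N) : f (j + 1) * f l ≤ f j * f (l + 1) := by
  induction l, hjl using Nat.le_induction with
  | base => exact (mul_comm _ _).le
  | succ l hjl ih =>
    have ih := ih (by lia)
    have h2 := hf l hl
    rcases (h0 (l + 1)).eq_or_lt with h | h
    · rw [← h, mul_zero]
      exact mul_nonneg (h0 _) (h0 _)
    · refine le_of_mul_le_mul_right ?_ h
      calc f (j + 1) * f (l + 1) * f (l + 1) = f (j + 1) * f (l + 1) ^ 2 := by ring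
        _ ≤ f (j + 1) * (f l * f (l + 2)) := mul_le_mul_of_nonneg_left h2 (h0 _)
        _ = f (j + 1) * f l * f (l + 2) := by ring
        _ ≤ f j * f (l + 1) * f (l + 2) := mul_le_mul_of_nonneg_right ih (h0 _)
        _ = f j * f (l + 1 + 1) * f (l + 1) := by ring

/-- Chaining unit steps: a relation between `f j * f (l + 1)` and `f (j + 1) * f l` for `j ≤ l`
extends to arbitrary nested pairs of indices. -/
lemma rel_mul_of_step (r : ℝ → ℝ → Prop) [Std.Refl r] [IsTrans ℝ r] {f : ℕ → ℝ} {N : ℕ}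
    (hstep : ∀ j l, j ≤ l → l + 1 ≤ N → r (f j * f (l + 1)) (f (j + 1) * f l)) (n : ℕ) :
    ∀ j l, j + n ≤ l → l + n ≤ N → r (f j * f (l + n)) (f (j + n) * f l) := by
  induction n with
  | zero => intro j l _ _; exact refl_of r _
  | succ n ih =>
    intro j l h1 h2
    have e1 := hstep j (l + n) (by lia) (by lia)
    have e2 := ih (j + 1) l (by lia) (by lia)
    rw [show j + 1 + n = j + (n + 1) by ring] at e2
    exact trans_of r e1 e2

lemma rel_mul_of_mul_le (r : ℝ → ℝ → Prop) [Std.Refl r] [IsTrans ℝ r] {f : ℕ → ℝ} {N : ℕ}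
    (hstep : ∀ j l, j ≤ l → l + 1 ≤ N → r (f j * f (l + 1)) (f (j + 1) * f l))
    {i l i' l' : ℕ} (hN : i + l ≤ N) (hsum : i + l = i' + l') (hle : i' * l' ≤ i * l) :
    r (f i' * f l') (f i * f l) := by
  wlog hil : i ≤ l generalizing i l
  · rw [mul_comm (f i)]
    exact this (by lia) (by lia) (by rwa [mul_comm l]) (by lia)
  wlog hil' : i' ≤ l' generalizing i' l'
  · rw [mul_comm (f i')]
    exact this (by lia) (by rwa [mul_comm l']) (by lia)
  -- For ordered pairs of equal sum, the smaller product belongs to the wider pair.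
  have hi : i' ≤ i := by
    by_contra! hlt
    obtain ⟨n, rfl⟩ := Nat.exists_eq_add_of_lt hlt
    obtain rfl : l = l' + n + 1 := by lia
    nlinarith
  obtain ⟨n, rfl⟩ := Nat.exists_eq_add_of_le hi
  obtain rfl : l' = l + n := by lia
  exact rel_mul_of_step r hstep n i' l hil (by lia)

lemma IsLogConcaveSeq.productsMono {h : ℕ → ℝ} (hh : IsLogConcaveSeq h) : ProductsMono h := by
  intro i l i' l' e1 e2
  refine rel_mul_of_mul_le (· ≤ ·) (N := i + l) (fun j l hjl hl => ?_) le_rfl e1 e2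
  refine mul_le_mul_of_logConcave hh.nonneg (fun n _ => hh.ineq n) ?_ hjl hl
  intro j m l hjm hml _ hm
  rcases hh.support m hm with h1 | h1
  · rw [h1 l hml, mul_zero]
  · rw [h1 j hjm, zero_mul]

lemma IsLogConvexSeq.productsAnti {h : ℕ → ℝ} (hh : IsLogConvexSeq h) : ProductsAnti h := by
  intro i l i' l' e1 e2
  exact rel_mul_of_mul_le (· ≥ ·) (N := i + l)
    (fun j l hjl hl => mul_le_mul_of_logConvex hh.nonneg (fun n _ => hh.ineq n) hjl hl) le_rfl e1 e2

/-! ### Values of the series at `x ≥ 0` -/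

section values

variable {h : ℕ → ℝ} {x : ℝ}

lemma hSeries_term_nonneg (h0 : ∀ k, 0 ≤ h k) (hx : 0 ≤ x) {a : ℝ} (ha : 0 ≤ a) (k : ℕ) :
    0 ≤ PowerSeries.coeff k (hSeries h a) * x ^ k := by
  rw [coeff_hSeries]
  exact mul_nonneg (mul_nonneg (h0 k) (hCoeff_nonneg ha k)) (pow_nonneg hx k)

lemma hSeries_term_le_add_one (h0 : ∀ k, 0 ≤ h k) (hx : 0 ≤ x) {a : ℝ} (ha : 0 ≤ a) (k : ℕ) :
    PowerSeries.coeff k (hSeries h a) * x ^ k ≤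
      PowerSeries.coeff k (hSeries h (a + 1)) * x ^ k := by
  rw [coeff_hSeries, coeff_hSeries]
  exact mul_le_mul_of_nonneg_right (mul_le_mul_of_nonneg_left (hCoeff_le_add_one ha k) (h0 k))
    (pow_nonneg hx k)

lemma seriesConvergesAt_of_add_one (h0 : ∀ k, 0 ≤ h k) (hx : 0 ≤ x) {a : ℝ} (ha : 0 ≤ a)
    (hc : SeriesConvergesAt (hSeries h (a + 1)) x) : SeriesConvergesAt (hSeries h a) x :=
  Summable.of_nonneg_of_le (hSeries_term_nonneg h0 hx ha) (hSeries_term_le_add_one h0 hx ha) hc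

/-- The terms grow with the parameter, so convergence at the largest shift gives all the
intermediate series used in chaining. -/
lemma seriesConvergesAt_of_le (h0 : ∀ k, 0 ≤ h k) (hx : 0 ≤ x) {μ : ℝ} (hμ : 0 ≤ μ) {n N : ℕ}
    (hn : n ≤ N) (hc : SeriesConvergesAt (hSeries h (μ + N)) x) :
    SeriesConvergesAt (hSeries h (μ + n)) x := by
  induction N, hn using Nat.le_induction with
  | base => exact hc
  | succ N _ ih =>
    refine ih (seriesConvergesAt_of_add_one h0 hx (by positivity) ?_)
    rwa [add_assoc, ← Nat.cast_succ]

lemma seriesSum_nonneg (h0 : ∀ k, 0 ≤ h k) (hx : 0 ≤ x) {a : ℝ} (ha : 0 ≤ a) :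
    0 ≤ seriesSum (hSeries h a) x :=
  tsum_nonneg (hSeries_term_nonneg h0 hx ha)

lemma seriesSum_le_add_one (h0 : ∀ k, 0 ≤ h k) (hx : 0 ≤ x) {a : ℝ} (ha : 0 ≤ a)
    (hc : SeriesConvergesAt (hSeries h (a + 1)) x) :
    seriesSum (hSeries h a) x ≤ seriesSum (hSeries h (a + 1)) x :=
  (seriesConvergesAt_of_add_one h0 hx ha hc).tsum_le_tsum (hSeries_term_le_add_one h0 hx ha) hc

lemma hasSum_sum_antidiagonal_mul {u v : ℕ → ℝ} (hu : Summable u) (hv : Summable v)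
    (hu0 : ∀ k, 0 ≤ u k) (hv0 : ∀ k, 0 ≤ v k) :
    HasSum (fun k => ∑ p ∈ antidiagonal k, u p.1 * v p.2) ((∑' k, u k) * ∑' k, v k) := by
  have huv := hu.mul_of_nonneg hv hu0 hv0
  rw [hu.tsum_mul_tsum_eq_tsum_sum_antidiagonal hv huv]
  exact (summable_sum_mul_antidiagonal_of_summable_mul huv).hasSum

/-- The Cauchy product of two convergent series of non-negative terms. -/
lemma hasSum_coeff_mul {p q : PowerSeries ℝ} (hp : SeriesConvergesAt p x)
    (hq : SeriesConvergesAt q x) (hp0 : ∀ k, 0 ≤ PowerSeries.coeff k p * x ^ k)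
    (hq0 : ∀ k, 0 ≤ PowerSeries.coeff k q * x ^ k) :
    HasSum (fun k => PowerSeries.coeff k (p * q) * x ^ k) (seriesSum p x * seriesSum q x) := by
  unfold seriesSum
  convert hasSum_sum_antidiagonal_mul hp hq hp0 hq0 using 2 with k
  rw [PowerSeries.coeff_mul, sum_mul]
  refine sum_congr rfl fun ij hij => ?_
  rw [← HasAntidiagonal.mem_antidiagonal.1 hij, pow_add]
  ring

lemma hasSum_shiftDefect (h0 : ∀ k, 0 ≤ h k) (hx : 0 ≤ x) {a : ℝ} (ha : 0 ≤ a)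
    (hc : SeriesConvergesAt (hSeries h (a + 1 + 1)) x) :
    HasSum (fun k => shiftDefect h 1 a k * x ^ k) (seriesSum (hSeries h (a + 1)) x ^ 2 -
      seriesSum (hSeries h a) x * seriesSum (hSeries h (a + 1 + 1)) x) := by
  have ha1 : 0 ≤ a + 1 := by linarith
  have ha2 : 0 ≤ a + 1 + 1 := by linarith
  have c1 := seriesConvergesAt_of_add_one h0 hx ha1 hc
  have c0 := seriesConvergesAt_of_add_one h0 hx ha c1
  have t0 := hSeries_term_nonneg h0 hx ha
  have t1 := hSeries_term_nonneg h0 hx ha1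
  have t2 := hSeries_term_nonneg h0 hx ha2
  have := (hasSum_coeff_mul c1 c1 t1 t1).sub (hasSum_coeff_mul c0 hc t0 t2)
  simpa only [shiftDefect, sub_mul, ← pow_two] using this

lemma seriesSum_logConcave (h0 : ∀ k, 0 ≤ h k) (hh : ProductsMono h) (hx : 0 ≤ x) {a : ℝ}
    (ha : 0 ≤ a) (hc : SeriesConvergesAt (hSeries h (a + 1 + 1)) x) :
    seriesSum (hSeries h a) x * seriesSum (hSeries h (a + 1 + 1)) x ≤
      seriesSum (hSeries h (a + 1)) x ^ 2 :=
  sub_nonneg.1 <| (hasSum_shiftDefect h0 hx ha hc).nonneg fun k =>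
    mul_nonneg (shiftDefect_nonneg hh hasShiftSignChange_one ha k) (pow_nonneg hx k)

lemma seriesSum_logConvex (h0 : ∀ k, 0 ≤ h k) (hh : ProductsAnti h) (hx : 0 ≤ x) {a : ℝ}
    (ha : 0 ≤ a) (hc : SeriesConvergesAt (hSeries h (a + 1 + 1)) x) :
    seriesSum (hSeries h (a + 1)) x ^ 2 ≤
      seriesSum (hSeries h a) x * seriesSum (hSeries h (a + 1 + 1)) x :=
  sub_nonpos.1 <| (hasSum_shiftDefect h0 hx ha hc).nonpos fun k =>
    mul_nonpos_of_nonpos_of_nonneg (shiftDefect_nonpos hh hasShiftSignChange_one ha k)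
      (pow_nonneg hx k)

lemma turanianValue_nonneg (h0 : ∀ k, 0 ≤ h k) (hh : ProductsMono h) (hx : 0 ≤ x) {μ : ℝ}
    (hμ : 0 ≤ μ) (α β : ℕ) (hc : SeriesConvergesAt (hSeries h (μ + α + β)) x) :
    0 ≤ turanianValue (hSeries h) μ α β x := by
  set f : ℕ → ℝ := fun n => seriesSum (hSeries h (μ + n)) x with hf
  have hc' : ∀ n, n ≤ α + β → SeriesConvergesAt (hSeries h (μ + n)) x := fun n hn =>
    seriesConvergesAt_of_le h0 hx hμ hn (by rwa [Nat.cast_add, ← add_assoc])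
  have hf0 : ∀ n, 0 ≤ f n := fun n => seriesSum_nonneg h0 hx (by positivity)
  have hmono : ∀ m j, j ≤ m → m ≤ α + β → f j ≤ f m := by
    intro m j hjm
    induction m, hjm using Nat.le_induction with
    | base => exact fun _ => le_rfl
    | succ m _ ih =>
      intro hm
      refine (ih (by lia)).trans ?_
      have := seriesSum_le_add_one h0 hx (a := μ + m) (by positivity)
        (by simpa [add_assoc] using hc' (m + 1) hm)
      simpa [hf, add_assoc] using this
  have key : f 0 * f (α + β) ≤ f α * f β := by
    refine rel_mul_of_mul_le (· ≤ ·) (N := α + β) (fun j l hjl hl => ?_) le_rfl (by simp) (by simp)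
    refine mul_le_mul_of_logConcave hf0 (fun n hn => ?_) (fun j m l hjm hml hl hm => ?_) hjl hl
    · have e1 : μ + n + 1 = μ + (n + 1 : ℕ) := by push_cast; ring
      have e2 : μ + (n + 1 : ℕ) + 1 = μ + (n + 2 : ℕ) := by push_cast; ring
      have := seriesSum_logConcave h0 hh hx (a := μ + n) (by positivity)
        (by rw [e1, e2]; exact hc' _ hn)
      rwa [e1, e2] at this
    -- Values increase with the shift, so a zero at `m` forces a zero at every `j ≤ m`.
    · rw [le_antisymm ((hmono m j hjm (hml.trans hl)).trans hm.le) (hf0 j), zero_mul]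
  have e : turanianValue (hSeries h) μ α β x = f α * f β - f 0 * f (α + β) := by
    simp [turanianValue, hf, add_assoc]
  rw [e]; linarith

lemma turanianValue_nonpos (h0 : ∀ k, 0 ≤ h k) (hh : ProductsAnti h) (hx : 0 ≤ x) {μ : ℝ}
    (hμ : 0 ≤ μ) (α β : ℕ) (hc : SeriesConvergesAt (hSeries h (μ + α + β)) x) :
    turanianValue (hSeries h) μ α β x ≤ 0 := by
  set f : ℕ → ℝ := fun n => seriesSum (hSeries h (μ + n)) x with hf
  have hf0 : ∀ n, 0 ≤ f n := fun n => seriesSum_nonneg h0 hx (by positivity)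
  have key : f α * f β ≤ f 0 * f (α + β) := by
    refine rel_mul_of_mul_le (· ≥ ·) (N := α + β) (fun j l hjl hl => ?_) le_rfl (by simp) (by simp)
    refine mul_le_mul_of_logConvex hf0 (fun n hn => ?_) hjl hl
    have e1 : μ + n + 1 = μ + (n + 1 : ℕ) := by push_cast; ring
    have e2 : μ + (n + 1 : ℕ) + 1 = μ + (n + 2 : ℕ) := by push_cast; ring
    have := seriesSum_logConvex h0 hh hx (a := μ + n) (by positivity) (by
      rw [e1, e2]
      exact seriesConvergesAt_of_le h0 hx hμ hn (by rwa [Nat.cast_add, ← add_assoc]))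
    rwa [e1, e2] at this
  have e : turanianValue (hSeries h) μ α β x = f α * f β - f 0 * f (α + β) := by
    simp [turanianValue, hf, add_assoc]
  rw [e]; linarith

end values

theorem mainTheorem3 (h : ℕ → ℝ) :
    (IsLogConcaveSeq h →
      (∀ μ : ℝ, 0 ≤ μ → ∀ α β : ℕ, 1 ≤ α → 1 ≤ β → ∀ x : ℝ, 0 ≤ x →
        TuranianConvergesAt (hSeries h) μ α β x →
          0 ≤ turanianValue (hSeries h) μ α β x) ∧
      (∀ μ : ℝ, 0 ≤ μ → ∀ α β : ℕ, 1 ≤ α → 1 ≤ β → α + β ≤ 4 → ∀ k : ℕ,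
        0 ≤ PowerSeries.coeff k (formalTuranian (hSeries h) μ α β))) ∧
    (IsLogConvexSeq h →
      (∀ μ : ℝ, 0 ≤ μ → ∀ α β : ℕ, 1 ≤ α → 1 ≤ β → ∀ x : ℝ, 0 ≤ x →
        TuranianConvergesAt (hSeries h) μ α β x →
          turanianValue (hSeries h) μ α β x ≤ 0) ∧
      (∀ μ : ℝ, 0 ≤ μ → ∀ α β : ℕ, 1 ≤ α → 1 ≤ β → α + β ≤ 4 → ∀ k : ℕ,
        PowerSeries.coeff k (formalTuranian (hSeries h) μ α β) ≤ 0)) := by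
  refine ⟨fun hh => ⟨fun μ hμ α β _ _ x hx hc => ?_, fun μ hμ α β hα hβ hαβ k => ?_⟩,
    fun hh => ⟨fun μ hμ α β _ _ x hx hc => ?_, fun μ hμ α β hα hβ hαβ k => ?_⟩⟩
  · exact turanianValue_nonneg hh.nonneg hh.productsMono hx hμ α β hc.2.2.2
  · exact coeff_formalTuranian_induction (P := fun y => 0 ≤ y) (fun _ _ => add_nonneg)
      (fun d a hd ha => shiftDefect_nonneg hh.productsMono hd ha k) hμ hα hβ hαβ
  · exact turanianValue_nonpos hh.nonneg hh.productsAnti hx hμ α β hc.2.2.2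
  · exact coeff_formalTuranian_induction (P := fun y => y ≤ 0) (fun _ _ => add_nonpos)
      (fun d a hd ha => shiftDefect_nonpos hh.productsAnti hd ha k) hμ hα hβ hαβ
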